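/- Consider the Cauchy problem in one space dimension ($n=1$, $\theta=2$) \[u_{tt}-\Delta u+(-\Delta)^2u_t=0\ \text{ in }(0,\infty)\times\mathbf R,\qquad u(0,\cdot)=u_0,\quad u_t(0,\cdot)=u_1 .\] A mild solution is a function $u\in C([0,\infty);H^1(\mathbf R))\cap C^1([0,\infty);L^2(\mathbf R))$ (complex-valued functions are allowed) that takes these initial values and satisfies the equation in the sense of tempered distributions in $x$ for every $t>0$. Write $\|\cdot\|$ for the norm of $L^2(\mathbf R)$, $\|f\|_1=\int_{\mathbf R}|f|\,dx$, $\|f\|_{1,1}=\int_{\mathbf R}(1+|x|)|f(x)|\,dx$, let $L^{1,1}(\mathbf R)$ be the space of $f\in L^1(\mathbf R)$ with $\|f\|_{1,1}<\infty$, and put $\|D^{s}f\|=\big(\int_{\mathbf R}|\xi|^{2s}|\hat f(\xi)|^2\,d\xi\big)^{1/2}$ with $\hat f(\xi)=(2\pi)^{-1/2}\int_{\mathbf R} e^{-ix\xi}f(x)\,dx$. Let \[P_1=\int_{\mathbf R}u_1(x)\,dx,\qquad I_0=\|u_0\|+\|u_0\|_1+\|u_0\|_{1,1}+\|D^{\ell}u_0\|+\|u_1\|+\|u_1\|_1+\|u_1\|_{1,1}+\|D^{\ell-1}u_1\|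 .\] Theorem. Let $\ell\ge 1$ be real. There are constants $C_1,C_2,T_0>0$, depending only on $\ell$, such that for all $[u_0,u_1]\in (H^{\ell}(\mathbf R)\cap L^{1,1}(\mathbf R))\times(H^{\ell-1}(\mathbf R)\cap L^{1,1}(\mathbf R))$ and every mild solution $u$ with these data \[C_1|P_1|\sqrt t\ \le\ \|u(t,\cdot)\|\ \le\ C_2 I_0\sqrt t\qquad (t\gg 1),\] where the upper bound holds for all $t\ge T_0$ and the lower bound holds for all $t\ge T$, with some $T$ that may depend on the data. -/

import Mathlib

open MeasureTheory
open scoped FourierTransform SchwartzMap LineDeriv Laplacian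

noncomputable section

namespace StrongDamping

/-- The Hilbert space `L²(ℝ)` of complex-valued functions. -/
abbrev L2 : Type := Lp (α := ℝ) ℂ 2

/-- An `L²` function, regarded as a tempered distribution. -/
abbrev toDistr (f : L2) : 𝓢'(ℝ, ℂ) := Lp.toTemperedDistribution f

/-- `f ∈ L^{1,1}(ℝ)`: `f` and `(1 + |x|) f` are integrable. -/
def MemL11 (f : L2) : Prop :=
  Integrable (fun x : ℝ => f x) ∧ Integrable (fun x : ℝ => (1 + |x|) * ‖f x‖)

/-- The norm `‖f‖₁` of `L¹(ℝ)`. -/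
def normL1 (f : L2) : ℝ := ∫ x : ℝ, ‖f x‖

/-- The weighted norm `‖f‖_{1,1} = ∫ (1 + |x|) |f(x)| dx`. -/
def normL11 (f : L2) : ℝ := ∫ x : ℝ, (1 + |x|) * ‖f x‖

/-- The total mass `P = ∫ f(x) dx`. -/
def mass (f : L2) : ℂ := ∫ x : ℝ, f x

/-- `‖D^s f‖ = (∫ |ξ|^{2s} |f̂(ξ)|² dξ)^{1/2}`, where `f̂` is the unitary Fourier transform with
kernel `(2π)^{-1/2} e^{-ixξ}`. Mathlib's transform `𝓕` has kernel `e^{-2πixη}`; the integral below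
is the same one after the substitution `ξ = 2πη`. -/
def normD (s : ℝ) (f : L2) : ℝ :=
  Real.sqrt (∫ η : ℝ, (2 * Real.pi * |η|) ^ (2 * s) * ‖(𝓕 f : L2) η‖ ^ 2)

/-- The size `I₀` of the initial data. -/
def dataSize (l : ℝ) (u₀ u₁ : L2) : ℝ :=
  ‖u₀‖ + normL1 u₀ + normL11 u₀ + normD l u₀ + ‖u₁‖ + normL1 u₁ + normL11 u₁ + normD (l - 1) u₁

/-- `u ∈ C([0,∞); H¹(ℝ))`: `u` and its weak derivative `∂ₓ u` are continuous from `[0,∞)` to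
`L²(ℝ)`. -/
def ContinuousInH1 (u : ℝ → L2) : Prop :=
  ContinuousOn u (Set.Ici 0) ∧
    ∃ w : ℝ → L2, ContinuousOn w (Set.Ici 0) ∧
      ∀ t : ℝ, 0 ≤ t → toDistr (w t) = ∂_{(1 : ℝ)} (toDistr (u t))

/-- The time derivative `u_t` on `[0,∞)`, one-sided at `t = 0`, in `L²(ℝ)`. -/
def timeDeriv (u : ℝ → L2) (t : ℝ) : L2 := derivWithin u (Set.Ici 0) t

/-- `u` is a mild solution of `u_tt - Δu + (-Δ)² u_t = 0`, `u(0) = u₀`, `u_t(0) = u₁` in the class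
`C([0,∞); H¹(ℝ)) ∩ C¹([0,∞); L²(ℝ))`. The equation holds in the sense of tempered distributions
in `x`, at each time `t > 0`. -/
structure IsMildSolution (u₀ u₁ : L2) (u : ℝ → L2) : Prop where
  continuousInH1 : ContinuousInH1 u
  contDiff : ContDiffOn ℝ 1 u (Set.Ici 0)
  init : u 0 = u₀
  init_deriv : timeDeriv u 0 = u₁
  equation : ∀ t : ℝ, 0 < t → ∀ φ : 𝓢(ℝ, ℂ),
    HasDerivAt (fun s : ℝ => toDistr (timeDeriv u s) φ)
      ((Δ (toDistr (u t)) - Δ (Δ (toDistr (timeDeriv u t)))) φ) t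

end StrongDamping

end

/-! With ξ = 2πx, v = û and w = û_t, the equation becomes the oscillator v'' + ξ²v + ξ⁴v' = 0 at
each frequency. Its energy |w|² + ξ²|v|² decreases, also after integration against a weight
(`energy_le`). The Fourier transform of an integrable u₁ is bounded by ‖u₁‖₁, continuous, and
proportional to the mass at 0.

Upper bound: split at |ξ| = κ = 1/t. Below κ, integrating the velocity gives t‖w(0)‖ ≲ t√κ = √t.
Above κ, the energy with weight 1/ξ² bounds ‖v‖² by ∫ |w(0)|²/ξ² + ‖v(0)‖² ≲ 1/κ + ‖v(0)‖². Lower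
bound: for |ξ| ≤ 1/(4t) the oscillator has barely turned, so v(t) ≈ v(0) + t w(0), and t w(0) has
norm of order |P₁|√t on this band.

Since ξ⁴w need not lie in L², time derivatives of w are taken only after truncation in frequency.
The truncated equation is derived in `isDampedOscillation`. -/

namespace StrongDamping

/-! ### Multiplication operators on L² -/

/-- `g` is a bounded measurable real symbol. -/
def BddSymbol (g : ℝ → ℝ) : Prop := Measurable g ∧ ∃ C : ℝ, ∀ x, |g x| ≤ C

theorem BddSymbol.memLp_mul {g : ℝ → ℝ} (hg : BddSymbol g) (f : L2) :
    MemLp (fun x => (g x : ℂ) * f x) 2 := by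
  obtain ⟨hm, C, hC⟩ := hg
  refine MemLp.of_le_mul (c := C) (Lp.memLp f) ?_ (Filter.Eventually.of_forall fun x => ?_)
  · exact (Complex.measurable_ofReal.comp hm).aestronglyMeasurable.mul
      (Lp.aestronglyMeasurable f)
  · rw [norm_mul, Complex.norm_real, Real.norm_eq_abs]
    exact mul_le_mul_of_nonneg_right (hC x) (norm_nonneg _)

theorem BddSymbol.exists_clm {g : ℝ → ℝ} (hg : BddSymbol g) :
    ∃ T : L2 →L[ℂ] L2, ∀ f : L2, T f =ᵐ[volume] fun x => (g x : ℂ) * f x := by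
  obtain ⟨C, hC⟩ := hg.2
  let L : L2 →ₗ[ℂ] L2 :=
    { toFun := fun f => (hg.memLp_mul f).toLp _
      map_add' := fun f h => by
        apply Lp.ext
        filter_upwards [(hg.memLp_mul (f + h)).coeFn_toLp, (hg.memLp_mul f).coeFn_toLp,
          (hg.memLp_mul h).coeFn_toLp, Lp.coeFn_add f h,
          Lp.coeFn_add ((hg.memLp_mul f).toLp _) ((hg.memLp_mul h).toLp _)] with x h1 h2 h3 h4 h5
        rw [h1, h5, Pi.add_apply, h2, h3, h4, Pi.add_apply, mul_add]
      map_smul' := fun c f => by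
        apply Lp.ext
        filter_upwards [(hg.memLp_mul (c • f)).coeFn_toLp, (hg.memLp_mul f).coeFn_toLp,
          Lp.coeFn_smul c f, Lp.coeFn_smul c ((hg.memLp_mul f).toLp _)] with x h1 h2 h3 h4
        rw [h1, RingHom.id_apply, h4, Pi.smul_apply, h2, h3, Pi.smul_apply, smul_eq_mul,
          smul_eq_mul, mul_left_comm] }
  refine ⟨L.mkContinuous C fun f => ?_, fun f => (hg.memLp_mul f).coeFn_toLp⟩
  refine Lp.norm_le_mul_norm_of_ae_le_mul ?_
  filter_upwards [(hg.memLp_mul f).coeFn_toLp] with x hx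
  change ‖((hg.memLp_mul f).toLp _ : L2) x‖ ≤ _
  rw [hx, norm_mul, Complex.norm_real, Real.norm_eq_abs]
  exact mul_le_mul_of_nonneg_right (hC x) (norm_nonneg _)

open Classical in
/-- Multiplication by the bounded symbol `g` on `L²(ℝ)` (and `0` if `g` is not a bounded symbol). -/
noncomputable def mulOp (g : ℝ → ℝ) : L2 →L[ℂ] L2 :=
  if hg : BddSymbol g then hg.exists_clm.choose else 0

theorem coeFn_mulOp {g : ℝ → ℝ} (hg : BddSymbol g) (f : L2) :
    mulOp g f =ᵐ[volume] fun x => (g x : ℂ) * f x := by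
  rw [mulOp, dif_pos hg]
  exact hg.exists_clm.choose_spec f

theorem norm_mulOp_le {a b : ℝ → ℝ} (ha : BddSymbol a) (hb : BddSymbol b) {C : ℝ}
    (h : ∀ x, |a x| ≤ C * |b x|) (f : L2) : ‖mulOp a f‖ ≤ C * ‖mulOp b f‖ := by
  refine Lp.norm_le_mul_norm_of_ae_le_mul ?_
  filter_upwards [coeFn_mulOp ha f, coeFn_mulOp hb f] with x h1 h2
  rw [h1, h2, norm_mul, norm_mul, Complex.norm_real, Complex.norm_real, Real.norm_eq_abs,
    Real.norm_eq_abs, ← mul_assoc]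
  exact mul_le_mul_of_nonneg_right (h x) (norm_nonneg _)

theorem norm_mulOp_le_self {a : ℝ → ℝ} (ha : BddSymbol a) {C : ℝ}
    (h : ∀ x, |a x| ≤ C) (f : L2) : ‖mulOp a f‖ ≤ C * ‖f‖ := by
  refine Lp.norm_le_mul_norm_of_ae_le_mul ?_
  filter_upwards [coeFn_mulOp ha f] with x h1
  rw [h1, norm_mul, Complex.norm_real, Real.norm_eq_abs]
  exact mul_le_mul_of_nonneg_right (h x) (norm_nonneg _)

theorem norm_sq_eq_integral (f : L2) : ‖f‖ ^ 2 = ∫ x, ‖f x‖ ^ 2 := by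
  have h := L2.inner_def (𝕜 := ℂ) f f
  have h2 : inner ℂ f f = ((‖f‖ ^ 2 : ℝ) : ℂ) := by
    rw [inner_self_eq_norm_sq_to_K]; simp
  have h3 : ∀ x, inner ℂ (f x) (f x) = ((‖f x‖ ^ 2 : ℝ) : ℂ) := fun x => by
    rw [inner_self_eq_norm_sq_to_K]; simp
  rw [h2] at h
  simp_rw [h3] at h
  rw [integral_complex_ofReal] at h
  exact_mod_cast h

theorem norm_sq_mulOp {a : ℝ → ℝ} (ha : BddSymbol a) (f : L2) :
    ‖mulOp a f‖ ^ 2 = ∫ x, a x ^ 2 * ‖f x‖ ^ 2 := by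
  rw [norm_sq_eq_integral]
  refine integral_congr_ae ?_
  filter_upwards [coeFn_mulOp ha f] with x hx
  rw [hx, norm_mul, Complex.norm_real, Real.norm_eq_abs, mul_pow, sq_abs]

/-- The indicator of a measurable set times a locally bounded function is a bounded symbol. -/
theorem bddSymbol_indicator {s : Set ℝ} (hs : MeasurableSet s) {g : ℝ → ℝ} (hg : Measurable g)
    {C : ℝ} (hC : ∀ x ∈ s, |g x| ≤ C) : BddSymbol (s.indicator g) := by
  refine ⟨hg.indicator hs, max C 0, fun x => ?_⟩
  by_cases hx : x ∈ s
  · rw [Set.indicator_of_mem hx]; exact (hC x hx).trans (le_max_left _ _)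
  · rw [Set.indicator_of_notMem hx, abs_zero]; exact le_max_right _ _

/-- A bounded symbol vanishing outside a bounded interval. -/
def CompactSymbol (g : ℝ → ℝ) : Prop := BddSymbol g ∧ ∃ R : ℝ, ∀ x, R ≤ |x| → g x = 0

theorem CompactSymbol.mul_pow {g : ℝ → ℝ} (hg : CompactSymbol g) (k : ℕ) :
    CompactSymbol (fun x => g x * (2 * Real.pi * x) ^ k) := by
  obtain ⟨⟨hm, C, hC⟩, R, hR⟩ := hg
  have h0 : 0 ≤ C := (abs_nonneg _).trans (hC 0)
  refine ⟨⟨hm.mul (by fun_prop), C * (2 * Real.pi * |R|) ^ k, fun x => ?_⟩, R, fun x hx => ?_⟩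
  · change |g x * (2 * Real.pi * x) ^ k| ≤ _
    by_cases hx : R ≤ |x|
    · rw [hR x hx, zero_mul, abs_zero]; positivity
    · rw [abs_mul, abs_pow, abs_mul, abs_of_pos Real.two_pi_pos]
      have : |x| ≤ |R| := (not_le.1 hx).le.trans (le_abs_self R)
      exact mul_le_mul (hC x) (by gcongr) (by positivity) h0
  · change g x * _ = 0
    rw [hR x hx, zero_mul]

/-! ### From the distributional equation to an L²-valued one -/

/-- The tempered-distribution pairing with a fixed Schwartz function, as a functional on `L²`. -/
theorem exists_pairing (ψ : 𝓢(ℝ, ℂ)) : ∃ T : L2 →L[ℂ] ℂ, ∀ f : L2, T f = toDistr f ψ := by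
  refine ⟨⟨⟨⟨fun f => toDistr f ψ, fun f g => ?_⟩, fun c f => ?_⟩, ?_⟩, fun f => rfl⟩
  · exact congrArg (fun T : 𝓢'(ℝ, ℂ) => T ψ)
      ((Lp.toTemperedDistributionCLM ℂ (volume : Measure ℝ) 2).map_add f g)
  · exact congrArg (fun T : 𝓢'(ℝ, ℂ) => T ψ)
      ((Lp.toTemperedDistributionCLM ℂ (volume : Measure ℝ) 2).map_smul c f)
  · exact (PointwiseConvergenceCLM.evalCLM _ _ ψ).continuous.comp
      (Lp.toTemperedDistributionCLM ℂ (volume : Measure ℝ) 2).continuous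

/-- Multiplication of a Schwartz function by `-(2πx)²`, the symbol of the Laplacian. -/
noncomputable def laplaceSymbol (ψ : 𝓢(ℝ, ℂ)) : 𝓢(ℝ, ℂ) :=
  (-(2 * (Real.pi : ℂ)) ^ 2) • SchwartzMap.smulLeftCLM ℂ (fun x : ℝ => ((‖x‖ ^ 2 : ℝ) : ℂ)) ψ

theorem laplaceSymbol_apply (ψ : 𝓢(ℝ, ℂ)) (x : ℝ) :
    laplaceSymbol ψ x = -(((2 * Real.pi * x) ^ 2 : ℝ) : ℂ) * ψ x := by
  have h : (fun x : ℝ => ((‖x‖ ^ 2 : ℝ) : ℂ)).HasTemperateGrowth := by fun_prop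
  rw [laplaceSymbol, _root_.smul_apply, SchwartzMap.smulLeftCLM_apply_apply h]
  rw [Real.norm_eq_abs, sq_abs, smul_eq_mul, smul_eq_mul]
  push_cast
  ring

theorem laplacian_apply_fourier (T : 𝓢'(ℝ, ℂ)) (ψ : 𝓢(ℝ, ℂ)) :
    (Δ T) (𝓕 ψ) = (𝓕 T) (laplaceSymbol ψ) := by
  have h : 𝓕 (Δ T) ψ = (𝓕 T) (laplaceSymbol ψ) := by
    rw [TemperedDistribution.laplacian_eq_fourierMultiplierCLM,
      ← Complex.coe_smul, FourierTransform.fourier_smul,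
      TemperedDistribution.fourierMultiplierCLM_apply, FourierTransform.fourier_fourierInv_eq,
      laplaceSymbol, map_smul]
    push_cast
    rfl
  exact h

theorem toDistr_fourier (f : L2) (ψ : 𝓢(ℝ, ℂ)) : toDistr f (𝓕 ψ) = toDistr (𝓕 f) ψ := by
  rw [toDistr, toDistr, ← Lp.fourier_toTemperedDistribution_eq]
  rfl

theorem toDistr_apply (f : L2) (ψ : 𝓢(ℝ, ℂ)) : toDistr f ψ = ∫ x, ψ x * f x := by
  rw [toDistr, Lp.toTemperedDistribution_apply]; rfl

/-- The frequency-side weak form of the equation. -/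
theorem IsMildSolution.hasDerivAt_pairing {u₀ u₁ : L2} {u : ℝ → L2}
    (hu : IsMildSolution u₀ u₁ u) {t : ℝ} (ht : 0 < t) (ψ : 𝓢(ℝ, ℂ)) :
    HasDerivAt (fun s => toDistr (𝓕 (timeDeriv u s)) ψ)
      (toDistr (𝓕 (u t)) (laplaceSymbol ψ) -
        toDistr (𝓕 (timeDeriv u t)) (laplaceSymbol (laplaceSymbol ψ))) t := by
  have h := hu.equation t ht (𝓕 ψ)
  simp_rw [toDistr_fourier] at h
  convert h using 1
  change _ = (Δ (toDistr (u t))) (𝓕 ψ) - (Δ (Δ (toDistr (timeDeriv u t)))) (𝓕 ψ)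
  have h2 : (𝓕 (Δ (toDistr (timeDeriv u t)))) (laplaceSymbol ψ) =
      (Δ (toDistr (timeDeriv u t))) (𝓕 (laplaceSymbol ψ)) := rfl
  rw [laplacian_apply_fourier, laplacian_apply_fourier, h2, laplacian_apply_fourier,
    ← toDistr_fourier, ← toDistr_fourier]
  rfl

theorem toDistr_mulOp {g : ℝ → ℝ} (hg : BddSymbol g) (f : L2) {ψ χ : 𝓢(ℝ, ℂ)}
    (h : ∀ x, ψ x * g x = χ x) : toDistr (mulOp g f) ψ = toDistr f χ := by
  rw [toDistr_apply, toDistr_apply]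
  refine integral_congr_ae ?_
  filter_upwards [coeFn_mulOp hg f] with x hx
  rw [hx, ← h x, mul_assoc]

/-- The `L²`-valued form of the Fourier-transformed equation, localised to bounded frequencies. -/
structure IsDampedOscillation (v w : ℝ → L2) : Prop where
  continuousOn : ContinuousOn w (Set.Ici 0)
  hasDerivWithinAt : ∀ t, 0 ≤ t → HasDerivWithinAt v (w t) (Set.Ici 0) t
  hasDerivAt_mulOp : ∀ g, CompactSymbol g → ∀ t, 0 < t →
    HasDerivAt (fun s => mulOp g (w s))
      (-(mulOp (fun x => g x * (2 * Real.pi * x) ^ 2) (v t) +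
        mulOp (fun x => g x * (2 * Real.pi * x) ^ 4) (w t))) t

/-- Freezing the function for negative times makes the fundamental theorem of calculus available on
all of ℝ. -/
theorem continuous_comp_max {E : Type*} [TopologicalSpace E] {f : ℝ → E}
    (hf : ContinuousOn f (Set.Ici 0)) : Continuous fun s => f (max s 0) :=
  hf.comp_continuous (by fun_prop) fun s => le_max_right s 0

theorem IsMildSolution.continuousOn_timeDeriv {u₀ u₁ : L2} {u : ℝ → L2}
    (hu : IsMildSolution u₀ u₁ u) : ContinuousOn (timeDeriv u) (Set.Ici 0) :=
  hu.contDiff.continuousOn_derivWithin (uniqueDiffOn_Ici 0) le_rfl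

theorem compactSymbol_indicator_one (R : ℝ) :
    CompactSymbol ((Set.Ioo (-R) R).indicator fun _ => 1) := by
  refine ⟨bddSymbol_indicator measurableSet_Ioo measurable_const (C := 1) (by simp), R, ?_⟩
  intro x hx
  refine Set.indicator_of_notMem (fun h => ?_) _
  exact absurd (abs_lt.2 h) (not_lt.2 hx)

/-- The integrated equation holds almost everywhere on a bounded frequency interval. -/
theorem IsMildSolution.ae_integrated {u₀ u₁ : L2} {u : ℝ → L2} (hu : IsMildSolution u₀ u₁ u)
    (R : ℝ) (G : ℝ → L2) (hG : Continuous G)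
    (hGeq : ∀ s, 0 ≤ s → G s = mulOp (fun x => (Set.Ioo (-R) R).indicator (fun _ => 1) x *
        (2 * Real.pi * x) ^ 2) (𝓕 (u s)) +
      mulOp (fun x => (Set.Ioo (-R) R).indicator (fun _ => 1) x *
        (2 * Real.pi * x) ^ 4) (𝓕 (timeDeriv u s))) {t : ℝ} (ht : 0 ≤ t) :
    ∀ᵐ x, x ∈ Set.Ioo (-R) R →
      (𝓕 (timeDeriv u t) - 𝓕 (timeDeriv u 0) + ∫ s in (0 : ℝ)..t, G s : L2) x = 0 := by
  refine isOpen_Ioo.ae_eq_zero_of_integral_contDiff_smul_eq_zero ?_ ?_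
  · exact ((Lp.memLp _).locallyIntegrable (by norm_num)).locallyIntegrableOn _
  intro g g_smooth g_cpt hgs
  have hg₁ : HasCompactSupport (Complex.ofRealCLM ∘ g) := g_cpt.comp_left rfl
  have hg₂ : ContDiff ℝ (⊤ : ℕ∞) (Complex.ofRealCLM ∘ g) := by fun_prop
  set ψ : 𝓢(ℝ, ℂ) := hg₁.toSchwartzMap hg₂
  have hψx : ∀ x, ψ x = (g x : ℂ) := fun x => rfl
  obtain ⟨T, hT⟩ := exists_pairing ψ
  have key : T (𝓕 (timeDeriv u t) - 𝓕 (timeDeriv u 0) + ∫ s in (0 : ℝ)..t, G s : L2) = 0 := by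
    have hc : ContinuousOn (fun s => 𝓕 (timeDeriv u s) : ℝ → L2) (Set.Ici 0) :=
      (Lp.fourierTransformₗᵢ ℝ ℂ).continuous.comp_continuousOn hu.continuousOn_timeDeriv
    have h1 : ∫ s in (0 : ℝ)..t, -(T (G s)) = T (𝓕 (timeDeriv u t)) - T (𝓕 (timeDeriv u 0)) := by
      refine intervalIntegral.integral_eq_sub_of_hasDerivAt_of_le ht
        (T.continuous.comp_continuousOn (hc.mono Set.Icc_subset_Ici_self)) (fun s hs => ?_)
        ((T.continuous.comp hG).neg.intervalIntegrable _ _)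
      rw [show (T ∘ fun s => 𝓕 (timeDeriv u s)) = fun s => toDistr (𝓕 (timeDeriv u s)) ψ from
        funext fun s => hT _]
      -- The test function is supported in the interval, so it does not see the sharp cutoff.
      have hz : ∀ x, ψ x * (((Set.Ioo (-R) R).indicator (fun _ => 1) x : ℝ) : ℂ) = ψ x := by
        intro x
        by_cases hx : x ∈ Set.Ioo (-R) R
        · rw [Set.indicator_of_mem hx]; simp
        · have : g x = 0 := image_eq_zero_of_notMem_tsupport fun h => hx (hgs h)
          rw [hψx, this]; simp
      have heq : -(T (G s)) = toDistr (𝓕 (u s)) (laplaceSymbol ψ) -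
          toDistr (𝓕 (timeDeriv u s)) (laplaceSymbol (laplaceSymbol ψ)) := by
        rw [hGeq s hs.1.le, map_add, hT, hT]
        rw [toDistr_mulOp (χ := -laplaceSymbol ψ) ((compactSymbol_indicator_one R).mul_pow 2).1,
          toDistr_mulOp (χ := laplaceSymbol (laplaceSymbol ψ))
            ((compactSymbol_indicator_one R).mul_pow 4).1, map_neg]
        · ring
        · intro x
          rw [laplaceSymbol_apply, laplaceSymbol_apply]
          have := hz x
          push_cast at this ⊢
          linear_combination (2 * (Real.pi : ℂ) * x) ^ 4 * this
        · intro x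
          change _ = -(laplaceSymbol ψ x)
          rw [laplaceSymbol_apply]
          have := hz x
          push_cast at this ⊢
          linear_combination (2 * (Real.pi : ℂ) * x) ^ 2 * this
      rw [heq]
      exact hu.hasDerivAt_pairing hs.1 ψ
    rw [map_add, map_sub, ← h1, ← T.intervalIntegral_comp_comm (hG.intervalIntegrable _ _),
      intervalIntegral.integral_neg, neg_add_cancel]
  rw [hT, toDistr_apply] at key
  rw [← key]
  rfl

theorem mulOp_congr_zero {g : ℝ → ℝ} (hg : BddSymbol g) {f : L2}
    (h : ∀ᵐ x, g x ≠ 0 → f x = 0) : mulOp g f = 0 := by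
  rw [Lp.eq_zero_iff_ae_eq_zero]
  filter_upwards [coeFn_mulOp hg f, h] with x h1 h2
  rw [h1]
  by_cases hx : g x = 0
  · simp [hx]
  · simp [h2 hx]

theorem mulOp_mulOp {a b c : ℝ → ℝ} (ha : BddSymbol a) (hb : BddSymbol b) (hc : BddSymbol c)
    (h : ∀ x, a x * b x = c x) (f : L2) : mulOp a (mulOp b f) = mulOp c f := by
  apply Lp.ext
  filter_upwards [coeFn_mulOp ha (mulOp b f), coeFn_mulOp hb f, coeFn_mulOp hc f] with x h1 h2 h3
  rw [h1, h2, h3, ← h x]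
  push_cast
  ring

/-- The weak equation, integrated in time, identifies the truncated w with the integral of a
continuous L²-valued function. Hence it is differentiable in norm. -/
theorem IsMildSolution.isDampedOscillation {u₀ u₁ : L2} {u : ℝ → L2}
    (hu : IsMildSolution u₀ u₁ u) :
    IsDampedOscillation (fun t => 𝓕 (u t)) (fun t => 𝓕 (timeDeriv u t)) := by
  let F : L2 →L[ℝ] L2 :=
    ((Lp.fourierTransformₗᵢ ℝ ℂ).toContinuousLinearEquiv : L2 →L[ℂ] L2).restrictScalars ℝ
  have hv : ContinuousOn (fun t => 𝓕 (u t) : ℝ → L2) (Set.Ici 0) :=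
    F.continuous.comp_continuousOn hu.contDiff.continuousOn
  have hw : ContinuousOn (fun t => 𝓕 (timeDeriv u t) : ℝ → L2) (Set.Ici 0) :=
    F.continuous.comp_continuousOn hu.continuousOn_timeDeriv
  refine ⟨hw, fun t ht => ?_, fun g hg t ht => ?_⟩
  · exact F.hasFDerivAt.comp_hasDerivWithinAt t
      ((hu.contDiff.differentiableOn one_ne_zero) t ht).hasDerivWithinAt
  obtain ⟨R, hR⟩ := hg.2
  have hi := compactSymbol_indicator_one R
  set e : ℝ → ℝ := (Set.Ioo (-R) R).indicator fun _ => 1 with he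
  set H : ℝ → L2 := fun s => mulOp (fun x => e x * (2 * Real.pi * x) ^ 2) (𝓕 (u s)) +
    mulOp (fun x => e x * (2 * Real.pi * x) ^ 4) (𝓕 (timeDeriv u s)) with hH
  have hHc : ContinuousOn H (Set.Ici 0) :=
    ((mulOp _).continuous.comp_continuousOn hv).add ((mulOp _).continuous.comp_continuousOn hw)
  have hGc := continuous_comp_max hHc
  have hge : ∀ x, g x * e x = g x := by
    intro x
    by_cases hx : x ∈ Set.Ioo (-R) R
    · rw [he, Set.indicator_of_mem hx, mul_one]
    · rw [hR x (not_lt.1 fun h => hx (abs_lt.1 h)), zero_mul]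
  have hrep : ∀ s, 0 ≤ s → mulOp g (𝓕 (timeDeriv u s)) = mulOp g (𝓕 (timeDeriv u 0)) -
      mulOp g (∫ r in (0 : ℝ)..s, H (max r 0)) := by
    intro s hs
    have h0 := hu.ae_integrated R _ hGc (fun r hr => by rw [max_eq_left hr]) hs
    have h1 : mulOp g (𝓕 (timeDeriv u s) - 𝓕 (timeDeriv u 0) +
        ∫ r in (0 : ℝ)..s, H (max r 0) : L2) = 0 := by
      refine mulOp_congr_zero hg.1 ?_
      filter_upwards [h0] with x hx hgx
      exact hx (abs_lt.1 (not_le.1 fun h => hgx (hR x h)))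
    rw [map_add, map_sub] at h1
    rw [eq_sub_iff_add_eq, ← sub_eq_zero, ← h1]
    abel
  have hd : HasDerivAt (fun s => mulOp g (𝓕 (timeDeriv u 0)) -
      mulOp g (∫ r in (0 : ℝ)..s, H (max r 0))) (-(mulOp g (H (max t 0)))) t := by
    have h2 := (hGc.integral_hasStrictDerivAt 0 t).hasDerivAt
    exact (((mulOp g).restrictScalars ℝ).hasFDerivAt.comp_hasDerivAt t h2).const_sub _
  have hHt : mulOp g (H (max t 0)) = mulOp (fun x => g x * (2 * Real.pi * x) ^ 2) (𝓕 (u t)) +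
        mulOp (fun x => g x * (2 * Real.pi * x) ^ 4) (𝓕 (timeDeriv u t)) := by
    rw [max_eq_left ht.le, hH, map_add, mulOp_mulOp hg.1 (hi.mul_pow 2).1 (hg.mul_pow 2).1,
      mulOp_mulOp hg.1 (hi.mul_pow 4).1 (hg.mul_pow 4).1]
    · intro x; rw [← mul_assoc, hge]
    · intro x; rw [← mul_assoc, hge]
  rw [hHt] at hd
  refine hd.congr_of_eventuallyEq ?_
  filter_upwards [lt_mem_nhds ht] with s hs
  exact hrep s hs.le

/-! ### Decay of the weighted energy -/

theorem real_inner_mulOp {a b c d : ℝ → ℝ} (ha : BddSymbol a) (hb : BddSymbol b)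
    (hc : BddSymbol c) (hd : BddSymbol d) (h : ∀ x, a x * b x = c x * d x) (f k : L2) :
    inner ℝ (mulOp a f) (mulOp b k) = inner ℝ (mulOp c f) (mulOp d k) := by
  rw [L2.inner_def, L2.inner_def]
  refine integral_congr_ae ?_
  filter_upwards [coeFn_mulOp ha f, coeFn_mulOp hb k, coeFn_mulOp hc f, coeFn_mulOp hd k]
    with x h1 h2 h3 h4
  simp only [h1, h2, h3, h4, ← Complex.real_smul, real_inner_smul_left, real_inner_smul_right]
  rw [← mul_assoc, ← mul_assoc, mul_comm (b x), mul_comm (d x), h x]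

theorem IsDampedOscillation.continuousOn_left {v w : ℝ → L2} (h : IsDampedOscillation v w) :
    ContinuousOn v (Set.Ici 0) := fun t ht => (h.hasDerivWithinAt t ht).continuousWithinAt

/-- The weighted energy of a damped oscillation does not increase. -/
theorem IsDampedOscillation.energy_le {v w : ℝ → L2} (h : IsDampedOscillation v w) {g : ℝ → ℝ}
    (hg : CompactSymbol g) {t : ℝ} (ht : 0 ≤ t) :
    ‖mulOp g (w t)‖ ^ 2 + ‖mulOp (fun x => g x * (2 * Real.pi * x)) (v t)‖ ^ 2 ≤
      ‖mulOp g (w 0)‖ ^ 2 + ‖mulOp (fun x => g x * (2 * Real.pi * x)) (v 0)‖ ^ 2 := by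
  have hg1 : CompactSymbol (fun x => g x * (2 * Real.pi * x)) := by simpa using hg.mul_pow 1
  have hg2 := hg.mul_pow 2
  have hg4 := hg.mul_pow 4
  set g1 : ℝ → ℝ := fun x => g x * (2 * Real.pi * x) with hg1_def
  set g2 : ℝ → ℝ := fun x => g x * (2 * Real.pi * x) ^ 2 with hg2_def
  set g4 : ℝ → ℝ := fun x => g x * (2 * Real.pi * x) ^ 4 with hg4_def
  let E : ℝ → ℝ := fun s => ‖mulOp g (w s)‖ ^ 2 + ‖mulOp g1 (v s)‖ ^ 2
  have hE : AntitoneOn E (Set.Ici 0) := by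
    have hd : ∀ s ∈ interior (Set.Ici (0 : ℝ)), HasDerivWithinAt E
        (2 * inner ℝ (mulOp g (w s)) (-(mulOp g2 (v s) + mulOp g4 (w s))) +
          2 * inner ℝ (mulOp g1 (v s)) (mulOp g1 (w s))) (interior (Set.Ici 0)) s := by
      intro s hs
      rw [interior_Ici] at hs
      have h1 := (h.hasDerivAt_mulOp g hg s hs).norm_sq
      have h2 : HasDerivAt (fun r => mulOp g1 (v r)) (mulOp g1 (w s)) s :=
        ((mulOp g1).restrictScalars ℝ).hasFDerivAt.comp_hasDerivAt s
          ((h.hasDerivWithinAt s hs.le).hasDerivAt (Ici_mem_nhds hs))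
      exact (h1.add h2.norm_sq).hasDerivWithinAt
    refine antitoneOn_of_hasDerivWithinAt_nonpos (convex_Ici 0) ?_ hd fun s hs => ?_
    · exact (((mulOp g).continuous.comp_continuousOn h.continuousOn).norm.pow 2).add
        (((mulOp g1).continuous.comp_continuousOn h.continuousOn_left).norm.pow 2)
    -- The potential terms cancel because g · gξ² = (gξ)²; the damping leaves -2‖gξ²w‖² ≤ 0.
    · have e1 : inner ℝ (mulOp g (w s)) (mulOp g2 (v s)) =
          inner ℝ (mulOp g1 (v s)) (mulOp g1 (w s)) := by
        rw [real_inner_comm]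
        exact real_inner_mulOp hg2.1 hg.1 hg1.1 hg1.1 (fun x => by
          simp only [hg1_def, hg2_def]; ring) _ _
      have e2 : inner ℝ (mulOp g (w s)) (mulOp g4 (w s)) = ‖mulOp g2 (w s)‖ ^ 2 := by
        rw [← real_inner_self_eq_norm_sq]
        exact real_inner_mulOp hg.1 hg4.1 hg2.1 hg2.1 (fun x => by
          simp only [hg4_def, hg2_def]; ring) _ _
      rw [inner_neg_right, inner_add_right, e1, e2]
      nlinarith [sq_nonneg ‖mulOp g2 (w s)‖]
  exact hE (Set.self_mem_Ici) ht ht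

/-! ### Low frequencies -/

/-- The indicator function of a set of frequencies. -/
noncomputable def cut (s : Set ℝ) : ℝ → ℝ := s.indicator fun _ => 1

theorem bddSymbol_cut {s : Set ℝ} (hs : MeasurableSet s) : BddSymbol (cut s) :=
  bddSymbol_indicator hs measurable_const (C := 1) (by simp)

theorem abs_cut_le (s : Set ℝ) (x : ℝ) : |cut s x| ≤ 1 := by
  by_cases hx : x ∈ s <;> simp [cut, hx]

theorem norm_cut_le {s : Set ℝ} (hs : MeasurableSet s) (f : L2) : ‖mulOp (cut s) f‖ ≤ ‖f‖ := by
  simpa using norm_mulOp_le_self (bddSymbol_cut hs) (abs_cut_le s) f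

theorem norm_sq_cut {s : Set ℝ} (hs : MeasurableSet s) (f : L2) :
    ‖mulOp (cut s) f‖ ^ 2 = ∫ x in s, ‖f x‖ ^ 2 := by
  rw [norm_sq_mulOp (bddSymbol_cut hs), ← integral_indicator hs]
  congr 1
  ext x
  by_cases hx : x ∈ s <;> simp [cut, hx]

/-- The frequencies `|ξ| ≤ κ`, in the variable `η = ξ / 2π`. -/
def low (κ : ℝ) : Set ℝ := {x | |2 * Real.pi * x| ≤ κ}

theorem low_eq_Icc (κ : ℝ) :
    low κ = Set.Icc (-(κ / (2 * Real.pi))) (κ / (2 * Real.pi)) := by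
  ext x
  rw [low, Set.mem_ofPred_eq, Set.mem_Icc, ← abs_le, le_div_iff₀ Real.two_pi_pos, abs_mul,
    abs_of_pos Real.two_pi_pos, mul_comm]

theorem measurableSet_low (κ : ℝ) : MeasurableSet (low κ) := by
  rw [low_eq_Icc]; exact measurableSet_Icc

theorem volume_real_low {κ : ℝ} (hκ : 0 ≤ κ) : volume.real (low κ) = κ / Real.pi := by
  have := Real.pi_pos
  rw [low_eq_Icc, Real.volume_real_Icc_of_le]
  · field_simp; ring
  · have : 0 ≤ κ / (2 * Real.pi) := by positivity
    linarith

theorem compactSymbol_low (κ : ℝ) : CompactSymbol (cut (low κ)) := by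
  refine ⟨bddSymbol_cut (measurableSet_low κ), κ / (2 * Real.pi) + 1, fun x hx => ?_⟩
  refine Set.indicator_of_notMem (fun h => ?_) _
  rw [low_eq_Icc, Set.mem_Icc, ← abs_le] at h
  linarith

theorem low_mul_pow_le (κ : ℝ) (j k : ℕ) (x : ℝ) :
    |cut (low κ) x * (2 * Real.pi * x) ^ (j + k)| ≤
      κ ^ j * |cut (low κ) x * (2 * Real.pi * x) ^ k| := by
  by_cases hx : x ∈ low κ
  · rw [cut, Set.indicator_of_mem hx, one_mul, one_mul, abs_pow, abs_pow, pow_add]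
    gcongr
    exact hx
  · simp [cut, Set.indicator_of_notMem hx]

theorem norm_low_mul_pow_le (κ : ℝ) (j k : ℕ) (f : L2) :
    ‖mulOp (fun x => cut (low κ) x * (2 * Real.pi * x) ^ (j + k)) f‖ ≤
      κ ^ j * ‖mulOp (fun x => cut (low κ) x * (2 * Real.pi * x) ^ k) f‖ :=
  norm_mulOp_le ((compactSymbol_low κ).mul_pow _).1 ((compactSymbol_low κ).mul_pow _).1
    (low_mul_pow_le κ j k) f

/-- The bound for the low-frequency energy in terms of the data. -/
noncomputable def lowBound (κ : ℝ) (v w : ℝ → L2) : ℝ := ‖mulOp (cut (low κ)) (w 0)‖ + κ * ‖v 0‖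

/-- Energy decay with the cutoff as weight, then a² + b² ≤ (a + b)² for the initial energy. -/
theorem IsDampedOscillation.low_energy {v w : ℝ → L2} (h : IsDampedOscillation v w) {κ : ℝ}
    (hκ : 0 ≤ κ) {t : ℝ} (ht : 0 ≤ t) :
    ‖mulOp (cut (low κ)) (w t)‖ ≤ lowBound κ v w ∧
      ‖mulOp (fun x => cut (low κ) x * (2 * Real.pi * x) ^ 1) (v t)‖ ≤ lowBound κ v w := by
  have he := h.energy_le (compactSymbol_low κ) ht
  have h1 : ‖mulOp (fun x => cut (low κ) x * (2 * Real.pi * x) ^ 1) (v 0)‖ ≤ κ * ‖v 0‖ := by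
    have := norm_low_mul_pow_le κ 1 0 (v 0)
    simp only [pow_zero, mul_one] at this
    refine this.trans ?_
    rw [pow_one]
    exact mul_le_mul_of_nonneg_left (norm_cut_le (measurableSet_low κ) _) hκ
  simp only [pow_one] at h1 ⊢
  have h0 : 0 ≤ κ * ‖v 0‖ := by positivity
  have hb : ‖mulOp (cut (low κ)) (w t)‖ ^ 2 +
      ‖mulOp (fun x => cut (low κ) x * (2 * Real.pi * x)) (v t)‖ ^ 2 ≤ lowBound κ v w ^ 2 := by
    refine he.trans ?_
    rw [lowBound]
    nlinarith [norm_nonneg (mulOp (cut (low κ)) (w 0)), norm_nonneg (mulOp (fun x =>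
      cut (low κ) x * (2 * Real.pi * x)) (v 0)), mul_nonneg (norm_nonneg
      (mulOp (cut (low κ)) (w 0))) h0]
  have hn : 0 ≤ lowBound κ v w := by rw [lowBound]; positivity
  constructor
  · refine le_of_sq_le_sq ?_ hn
    nlinarith [sq_nonneg ‖mulOp (fun x => cut (low κ) x * (2 * Real.pi * x)) (v t)‖]
  · refine le_of_sq_le_sq ?_ hn
    nlinarith [sq_nonneg ‖mulOp (cut (low κ)) (w t)‖]

theorem IsDampedOscillation.hasDerivWithinAt_mulOp {v w : ℝ → L2} (h : IsDampedOscillation v w)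
    (g : ℝ → ℝ) {t : ℝ} (ht : 0 ≤ t) :
    HasDerivWithinAt (fun s => mulOp g (v s)) (mulOp g (w t)) (Set.Ici 0) t :=
  ((mulOp g).restrictScalars ℝ).hasFDerivAt.comp_hasDerivWithinAt t (h.hasDerivWithinAt t ht)

theorem IsDampedOscillation.norm_low_le {v w : ℝ → L2} (h : IsDampedOscillation v w) {κ : ℝ}
    (hκ : 0 ≤ κ) {t : ℝ} (ht : 0 ≤ t) :
    ‖mulOp (cut (low κ)) (v t)‖ ≤ ‖v 0‖ + t * lowBound κ v w := by
  have h1 := norm_image_sub_le_of_norm_deriv_le_segment' (a := 0) (b := t)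
    (f := fun s => mulOp (cut (low κ)) (v s)) (f' := fun s => mulOp (cut (low κ)) (w s))
    (C := lowBound κ v w)
    (fun s hs => (h.hasDerivWithinAt_mulOp _ hs.1).mono Set.Icc_subset_Ici_self)
    (fun s hs => (h.low_energy hκ hs.1).1) t (Set.right_mem_Icc.2 ht)
  have h2 := norm_le_norm_add_norm_sub' (mulOp (cut (low κ)) (v t)) (mulOp (cut (low κ)) (v 0))
  have h3 := norm_cut_le (measurableSet_low κ) (v 0)
  simp only [sub_zero] at h1
  linarith

/-- In the acceleration -(ξ²v + ξ⁴w), one factor ξ stays with v so that the energy controls ξv; the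
remaining factors cost κ and κ⁴. -/
theorem IsDampedOscillation.norm_low_velocity_sub_le {v w : ℝ → L2} (h : IsDampedOscillation v w)
    {κ : ℝ} (hκ : 0 ≤ κ) {t : ℝ} (ht : 0 ≤ t) :
    ‖mulOp (cut (low κ)) (w t) - mulOp (cut (low κ)) (w 0)‖ ≤
      (κ + κ ^ 4) * lowBound κ v w * t := by
  have hb : ∀ s ∈ Set.Ico 0 t, 0 < s →
      ‖-(mulOp (fun x => cut (low κ) x * (2 * Real.pi * x) ^ 2) (v s) +
        mulOp (fun x => cut (low κ) x * (2 * Real.pi * x) ^ 4) (w s))‖ ≤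
          (κ + κ ^ 4) * lowBound κ v w := by
    intro s hs _
    have e := h.low_energy hκ hs.1
    rw [norm_neg, add_mul]
    refine (norm_add_le _ _).trans (add_le_add ?_ ?_)
    · refine (norm_low_mul_pow_le κ 1 1 (v s)).trans ?_
      rw [pow_one]
      exact mul_le_mul_of_nonneg_left e.2 hκ
    · have := norm_low_mul_pow_le κ 4 0 (w s)
      simp only [pow_zero, mul_one] at this
      exact this.trans (mul_le_mul_of_nonneg_left e.1 (by positivity))
  have hc : ContinuousOn (fun s => mulOp (cut (low κ)) (w s)) (Set.Ici 0) :=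
    (mulOp _).continuous.comp_continuousOn h.continuousOn
  -- The equation holds only for positive times, so the estimate starts at ε and then ε → 0.
  have key : ∀ ε, 0 < ε → ε ≤ t → ‖mulOp (cut (low κ)) (w t) - mulOp (cut (low κ)) (w ε)‖ ≤
      (κ + κ ^ 4) * lowBound κ v w * (t - ε) := by
    intro ε hε hεt
    refine norm_image_sub_le_of_norm_deriv_le_segment' (a := ε) (b := t)
      (f := fun s => mulOp (cut (low κ)) (w s))
      (fun s hs => (h.hasDerivAt_mulOp _ (compactSymbol_low κ) s
        (hε.trans_le hs.1)).hasDerivWithinAt)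
      (fun s hs => hb s ⟨hε.le.trans hs.1, hs.2⟩ (hε.trans_le hs.1)) t (Set.right_mem_Icc.2 hεt)
  rcases ht.eq_or_lt with rfl | ht'
  · simp
  have hlim : Filter.Tendsto (fun ε => ‖mulOp (cut (low κ)) (w t) - mulOp (cut (low κ)) (w ε)‖)
      (nhdsWithin 0 (Set.Ioi 0))
      (nhds ‖mulOp (cut (low κ)) (w t) - mulOp (cut (low κ)) (w 0)‖) :=
    (((hc 0 Set.self_mem_Ici).mono Set.Ioi_subset_Ici_self).tendsto.const_sub _).norm
  refine le_of_tendsto hlim ?_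
  filter_upwards [Ioc_mem_nhdsGT ht'] with ε hε
  refine (key ε hε.1 hε.2).trans ?_
  have : 0 ≤ lowBound κ v w := by rw [lowBound]; positivity
  exact mul_le_mul_of_nonneg_left (by linarith [hε.1]) (by positivity)

/-- At low frequencies the solution is close to its linearisation in time. -/
theorem IsDampedOscillation.norm_low_sub_linear_le {v w : ℝ → L2} (h : IsDampedOscillation v w)
    {κ : ℝ} (hκ : 0 ≤ κ) {t : ℝ} (ht : 0 ≤ t) :
    ‖mulOp (cut (low κ)) (v t) - mulOp (cut (low κ)) (v 0) - t • mulOp (cut (low κ)) (w 0)‖ ≤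
      (κ + κ ^ 4) * lowBound κ v w * t * t := by
  have h1 := norm_image_sub_le_of_norm_deriv_le_segment' (a := 0) (b := t)
    (f := fun s => mulOp (cut (low κ)) (v s) - s • mulOp (cut (low κ)) (w 0))
    (f' := fun s => mulOp (cut (low κ)) (w s) - (1 : ℝ) • mulOp (cut (low κ)) (w 0))
    (C := (κ + κ ^ 4) * lowBound κ v w * t)
    (fun s hs => ((h.hasDerivWithinAt_mulOp _ hs.1).mono Set.Icc_subset_Ici_self).sub
      ((hasDerivAt_id s).smul_const _).hasDerivWithinAt)
    (fun s hs => by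
      rw [one_smul]
      refine (h.norm_low_velocity_sub_le hκ hs.1).trans ?_
      have : 0 ≤ lowBound κ v w := by rw [lowBound]; positivity
      exact mul_le_mul_of_nonneg_left hs.2.le (by positivity)) t (Set.right_mem_Icc.2 ht)
  simp only [zero_smul, sub_zero] at h1
  rwa [sub_right_comm] at h1

theorem norm_low_le_of_bound {f : L2} {M : ℝ} (hM : 0 ≤ M) (hf : ∀ᵐ x, ‖f x‖ ≤ M) {κ : ℝ}
    (hκ : 0 ≤ κ) : ‖mulOp (cut (low κ)) f‖ ≤ M * Real.sqrt κ := by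
  refine le_of_sq_le_sq ?_ (by positivity)
  rw [norm_sq_cut (measurableSet_low κ), mul_pow, Real.sq_sqrt hκ]
  have h1 : ∫ x in low κ, ‖f x‖ ^ 2 ≤ ∫ x in low κ, M ^ 2 := by
    refine integral_mono_ae ((Lp.memLp f).integrable_norm_pow (by norm_num)).integrableOn
      (integrableOn_const (by rw [low_eq_Icc]; exact measure_Icc_lt_top.ne)) ?_
    filter_upwards [ae_restrict_of_ae hf] with x hx
    exact pow_le_pow_left₀ (norm_nonneg _) hx 2
  rw [setIntegral_const, volume_real_low hκ, smul_eq_mul] at h1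
  refine h1.trans ?_
  have : κ / Real.pi ≤ κ := div_le_self hκ (by linarith [Real.pi_gt_three])
  nlinarith [sq_nonneg M]

theorem le_norm_low_of_bound {f : L2} {m κ : ℝ} (hm : 0 ≤ m) (hκ : 0 ≤ κ)
    (hf : ∀ᵐ x, x ∈ low κ → m ≤ ‖f x‖) :
    m * Real.sqrt (κ / Real.pi) ≤ ‖mulOp (cut (low κ)) f‖ := by
  have := Real.pi_pos
  refine le_of_sq_le_sq ?_ (norm_nonneg _)
  rw [norm_sq_cut (measurableSet_low κ), mul_pow, Real.sq_sqrt (by positivity)]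
  have h1 : ∫ x in low κ, m ^ 2 ≤ ∫ x in low κ, ‖f x‖ ^ 2 := by
    refine integral_mono_ae (integrableOn_const (by rw [low_eq_Icc]; exact measure_Icc_lt_top.ne))
      ((Lp.memLp f).integrable_norm_pow (by norm_num)).integrableOn ?_
    filter_upwards [(ae_restrict_iff' (measurableSet_low κ)).2 hf] with x hx
    exact pow_le_pow_left₀ hm hx 2
  rw [setIntegral_const, volume_real_low hκ, smul_eq_mul] at h1
  linarith

/-! ### Frequencies above κ, with the weight 1/ξ -/

theorem integrable_inv_one_add_sq_scaled {κ : ℝ} (hκ : 0 < κ) :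
    Integrable (fun x : ℝ => (1 + (2 * Real.pi / κ * x) ^ 2)⁻¹) := by
  have : 2 * Real.pi / κ ≠ 0 := by positivity
  exact integrable_inv_one_add_sq.comp_mul_left' this

theorem integral_inv_one_add_sq_scaled {κ : ℝ} (hκ : 0 < κ) :
    ∫ x : ℝ, (1 + (2 * Real.pi / κ * x) ^ 2)⁻¹ = κ / 2 := by
  have h := Measure.integral_comp_mul_left (fun y : ℝ => (1 + y ^ 2)⁻¹) (2 * Real.pi / κ)
  have h2 : 0 < 2 * Real.pi / κ := by positivity
  rw [h, integral_univ_inv_one_add_sq, abs_of_pos (inv_pos.2 h2), smul_eq_mul]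
  field_simp

/-- The frequencies `|ξ| > κ` with `|η| < R`. -/
def mid (κ R : ℝ) : Set ℝ := Set.Ioo (-R) R \ low κ

theorem measurableSet_mid (κ R : ℝ) : MeasurableSet (mid κ R) :=
  measurableSet_Ioo.diff (measurableSet_low κ)

/-- The symbol `1 / ξ` on the middle frequencies. -/
noncomputable def midInv (κ R : ℝ) : ℝ → ℝ :=
  (mid κ R).indicator fun x => (2 * Real.pi * x)⁻¹

theorem lt_abs_of_mem_mid {κ R x : ℝ} (hx : x ∈ mid κ R) : κ < |2 * Real.pi * x| :=
  not_le.1 hx.2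

theorem compactSymbol_midInv {κ : ℝ} (hκ : 0 < κ) (R : ℝ) : CompactSymbol (midInv κ R) := by
  refine ⟨bddSymbol_indicator (measurableSet_mid κ R) (by fun_prop) (C := κ⁻¹) fun x hx => ?_, R,
    fun x hx => Set.indicator_of_notMem (fun h => ?_) _⟩
  · rw [abs_inv]
    exact inv_anti₀ hκ (lt_abs_of_mem_mid hx).le
  · exact absurd (abs_lt.2 h.1) (not_lt.2 hx)

theorem midInv_mul {κ : ℝ} (hκ : 0 < κ) (R : ℝ) :
    (fun x => midInv κ R x * (2 * Real.pi * x)) = cut (mid κ R) := by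
  ext x
  by_cases hx : x ∈ mid κ R
  · have : 2 * Real.pi * x ≠ 0 := abs_pos.1 (hκ.trans (lt_abs_of_mem_mid hx))
    rw [midInv, cut, Set.indicator_of_mem hx, Set.indicator_of_mem hx, inv_mul_cancel₀ this]
  · rw [midInv, cut, Set.indicator_of_notMem hx, Set.indicator_of_notMem hx, zero_mul]

/-- For |ξ| > κ one has 2ξ² ≥ κ² + ξ². The majorant is independent of R and has an explicit
integral. -/
theorem midInv_sq_le {κ : ℝ} (hκ : 0 < κ) (R x : ℝ) :
    midInv κ R x ^ 2 ≤ 2 / κ ^ 2 * (1 + (2 * Real.pi / κ * x) ^ 2)⁻¹ := by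
  by_cases hx : x ∈ mid κ R
  · have h1 : κ ^ 2 < (2 * Real.pi * x) ^ 2 := by
      rw [← sq_abs (2 * Real.pi * x)]
      exact pow_lt_pow_left₀ (lt_abs_of_mem_mid hx) hκ.le (by norm_num)
    rw [midInv, Set.indicator_of_mem hx]
    have e : 2 / κ ^ 2 * (1 + (2 * Real.pi / κ * x) ^ 2)⁻¹ =
        2 / (κ ^ 2 + (2 * Real.pi * x) ^ 2) := by
      have : κ ^ 2 + (2 * Real.pi * x) ^ 2 ≠ 0 := by positivity
      field_simp
    rw [e, inv_pow, inv_eq_one_div, div_le_div_iff₀ ((by positivity : 0 < κ ^ 2).trans h1)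
      (by positivity)]
    linarith
  · rw [midInv, Set.indicator_of_notMem hx, zero_pow two_ne_zero]
    positivity

theorem norm_midInv_le_of_bound {f : L2} {M : ℝ} (hf : ∀ᵐ x, ‖f x‖ ≤ M) {κ : ℝ}
    (hκ : 0 < κ) (R : ℝ) : ‖mulOp (midInv κ R) f‖ ^ 2 ≤ M ^ 2 / κ := by
  have hc := (compactSymbol_midInv hκ R).1
  rw [norm_sq_mulOp hc]
  have hi := (integrable_inv_one_add_sq_scaled hκ).const_mul (M ^ 2 * (2 / κ ^ 2))
  have h1 : ∫ x, midInv κ R x ^ 2 * ‖f x‖ ^ 2 ≤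
      ∫ x, M ^ 2 * (2 / κ ^ 2) * (1 + (2 * Real.pi / κ * x) ^ 2)⁻¹ := by
    refine integral_mono_of_nonneg (Filter.Eventually.of_forall fun x => by positivity) hi ?_
    filter_upwards [hf] with x hx
    rw [mul_comm, mul_assoc]
    exact mul_le_mul (pow_le_pow_left₀ (norm_nonneg _) hx 2) (midInv_sq_le hκ R x)
      (sq_nonneg _) (sq_nonneg _)
  rw [integral_const_mul, integral_inv_one_add_sq_scaled hκ] at h1
  refine h1.trans_eq ?_
  field_simp

/-- The weight 1/ξ turns the potential energy into the plain norm of v. The bound does not depend on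
R. -/
theorem IsDampedOscillation.norm_mid_le {v w : ℝ → L2} (h : IsDampedOscillation v w) {κ : ℝ}
    (hκ : 0 < κ) (R : ℝ) {M : ℝ} (hM : 0 ≤ M) (hw : ∀ᵐ x, ‖w 0 x‖ ≤ M) {t : ℝ} (ht : 0 ≤ t) :
    ‖mulOp (cut (mid κ R)) (v t)‖ ≤ M / Real.sqrt κ + ‖v 0‖ := by
  have he := h.energy_le (compactSymbol_midInv hκ R) ht
  rw [midInv_mul hκ] at he
  have h1 := norm_midInv_le_of_bound hw hκ R
  have h2 := norm_cut_le (measurableSet_mid κ R) (v 0)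
  refine le_of_sq_le_sq ?_ (by positivity)
  have h3 : (M / Real.sqrt κ) ^ 2 = M ^ 2 / κ := by rw [div_pow, Real.sq_sqrt hκ.le]
  have h4 : 0 ≤ M / Real.sqrt κ * ‖v 0‖ := by positivity
  nlinarith [sq_nonneg ‖mulOp (midInv κ R) (w t)‖, norm_nonneg (mulOp (cut (mid κ R)) (v 0))]

/-! ### The two bounds on the frequency side -/

theorem norm_le_of_cut_le {f : L2} {K : ℝ} (hK : 0 ≤ K)
    (h : ∀ R : ℝ, ‖mulOp (cut (Set.Ioo (-R) R)) f‖ ≤ K) : ‖f‖ ≤ K := by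
  refine le_of_sq_le_sq ?_ hK
  rw [norm_sq_eq_integral]
  have hA : AECover (volume : Measure ℝ) Filter.atTop fun R : ℝ => Set.Ioo (-R) R :=
    aecover_Ioo Filter.tendsto_neg_atTop_atBot Filter.tendsto_id
  refine le_of_tendsto (hA.integral_tendsto_of_countably_generated
    ((Lp.memLp f).integrable_norm_pow (by norm_num))) (Filter.Eventually.of_forall fun R => ?_)
  rw [← norm_sq_cut measurableSet_Ioo]
  exact pow_le_pow_left₀ (norm_nonneg _) (h R) 2

theorem norm_cut_Ioo_le (κ R : ℝ) (f : L2) : ‖mulOp (cut (Set.Ioo (-R) R)) f‖ ≤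
    ‖mulOp (cut (low κ)) f‖ + ‖mulOp (cut (mid κ R)) f‖ := by
  refine le_trans ?_ (norm_add_le _ _)
  refine Lp.norm_le_norm_of_ae_le ?_
  filter_upwards [coeFn_mulOp (bddSymbol_cut (measurableSet_Ioo (a := -R) (b := R))) f,
    coeFn_mulOp (bddSymbol_cut (measurableSet_low κ)) f,
    coeFn_mulOp (bddSymbol_cut (measurableSet_mid κ R)) f,
    Lp.coeFn_add (mulOp (cut (low κ)) f) (mulOp (cut (mid κ R)) f)] with x h1 h2 h3 h4
  rw [h1, h4, Pi.add_apply, h2, h3]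
  by_cases hl : x ∈ low κ <;> by_cases hR : x ∈ Set.Ioo (-R) R
  all_goals simp [cut, mid, Set.indicator, hl, hR]

/-- The upper bound on the frequency side. -/
theorem IsDampedOscillation.norm_le {v w : ℝ → L2} (h : IsDampedOscillation v w)
    {M : ℝ} (hM : 0 ≤ M) (hw : ∀ᵐ x, ‖w 0 x‖ ≤ M) {t : ℝ} (ht : 0 < t) :
    ‖v t‖ ≤ 3 * ‖v 0‖ + 2 * (M * Real.sqrt t) := by
  -- The split κ = 1/t balances t · M√κ against M/√κ; both equal M√t.
  have hκ : 0 < t⁻¹ := inv_pos.2 ht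
  refine norm_le_of_cut_le (by positivity) fun R => (norm_cut_Ioo_le t⁻¹ R _).trans ?_
  have h1 := h.norm_low_le hκ.le ht.le
  have h2 := h.norm_mid_le hκ R hM hw ht.le
  have h3 := norm_low_le_of_bound hM hw hκ.le
  have hs : 0 < Real.sqrt t := Real.sqrt_pos.2 ht
  have hst : t = Real.sqrt t * Real.sqrt t := (Real.mul_self_sqrt ht.le).symm
  have e1 : t * lowBound t⁻¹ v w ≤ M * Real.sqrt t + ‖v 0‖ := by
    rw [lowBound, mul_add, mul_inv_cancel_left₀ ht.ne']
    have := mul_le_mul_of_nonneg_left h3 ht.le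
    have e : t * (M * Real.sqrt t⁻¹) = M * Real.sqrt t := by
      rw [Real.sqrt_inv]
      nth_rewrite 1 [hst]
      field_simp
    linarith
  have e2 : M / Real.sqrt t⁻¹ = M * Real.sqrt t := by rw [Real.sqrt_inv, div_inv_eq_mul]
  rw [e2] at h2
  linarith

/-- The lower bound on the frequency side. -/
theorem IsDampedOscillation.le_norm {v w : ℝ → L2} (h : IsDampedOscillation v w)
    {m : ℝ} (hm : 0 ≤ m) {t : ℝ} (ht : 1 ≤ t)
    (hw : ∀ᵐ x, x ∈ low (1 / 4 / t) → m ≤ ‖w 0 x‖) :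
    m * Real.sqrt t / 8 - 2 * ‖v 0‖ ≤ ‖v t‖ := by
  have ht0 : 0 < t := by linarith
  -- With κt = 1/4 the linearisation error has the factor (1 + κ³)/4 ≤ 1/2, so it absorbs at most
  -- half of t‖c‖.
  set κ := 1 / 4 / t with hκ_def
  have hκ : 0 < κ := by positivity
  have hκt : κ * t = 1 / 4 := by rw [hκ_def]; field_simp
  have hκ1 : κ ≤ 1 / 4 := by nlinarith
  have h1 := h.norm_low_sub_linear_le hκ.le ht0.le
  have h2 := le_norm_low_of_bound hm hκ.le hw
  have h3 := norm_cut_le (measurableSet_low κ) (v 0)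
  have h4 := norm_cut_le (measurableSet_low κ) (v t)
  set a := mulOp (cut (low κ)) (v t)
  set b := mulOp (cut (low κ)) (v 0)
  set c := mulOp (cut (low κ)) (w 0) with hc
  have h5 : ‖t • c‖ ≤ ‖a‖ + ‖b‖ + ‖a - b - t • c‖ := by
    have e : t • c = a - b - (a - b - t • c) := by abel
    calc ‖t • c‖ = ‖a - b - (a - b - t • c)‖ := by rw [← e]
      _ ≤ ‖a - b‖ + ‖a - b - t • c‖ := norm_sub_le _ _
      _ ≤ _ := by gcongr; exact norm_sub_le _ _
  rw [norm_smul, Real.norm_eq_abs, abs_of_pos ht0] at h5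
  have h6 : (κ + κ ^ 4) * lowBound κ v w * t * t ≤ t * ‖c‖ / 2 + ‖v 0‖ / 8 := by
    have e : (κ + κ ^ 4) * lowBound κ v w * t * t =
        ((1 + κ ^ 3) * (κ * t)) * (t * ‖c‖ + (κ * t) * ‖v 0‖) := by
      rw [lowBound, ← hc]; ring
    rw [e, hκt]
    have e3 : κ ^ 3 ≤ 1 := pow_le_one₀ hκ.le (by linarith)
    have e4 : 0 ≤ t * ‖c‖ + 1 / 4 * ‖v 0‖ := by positivity
    calc (1 + κ ^ 3) * (1 / 4) * (t * ‖c‖ + 1 / 4 * ‖v 0‖)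
        ≤ (1 / 2) * (t * ‖c‖ + 1 / 4 * ‖v 0‖) :=
          mul_le_mul_of_nonneg_right (by linarith) e4
      _ = _ := by ring
  have h7 : m * Real.sqrt t / 4 ≤ t * ‖c‖ := by
    refine le_trans ?_ (mul_le_mul_of_nonneg_left h2 ht0.le)
    -- After squaring, this is t/16 ≤ t/(4π), that is, π ≤ 4.
    have hp : Real.sqrt t / 4 ≤ t * Real.sqrt (κ / Real.pi) := by
      refine le_of_sq_le_sq ?_ (by positivity)
      have := Real.pi_pos
      rw [mul_pow, div_pow, Real.sq_sqrt ht0.le, Real.sq_sqrt (by positivity)]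
      have e : t ^ 2 * (κ / Real.pi) = t / (4 * Real.pi) := by rw [hκ_def]; field_simp
      rw [e, div_le_div_iff₀ (by norm_num) (by positivity)]
      nlinarith [Real.pi_lt_four]
    nlinarith
  linarith [norm_nonneg (v 0)]

/-! ### The Fourier transform of integrable data -/

theorem continuous_fourier_of_integrable {f : ℝ → ℂ} (hf : Integrable f) : Continuous (𝓕 f) :=
  VectorFourier.fourierIntegral_continuous Real.continuous_fourierChar (L := innerₗ ℝ)
    continuous_inner hf

/-- On `L¹ ∩ L²` the Fourier transform is given by the Fourier integral. -/
theorem coeFn_fourier_of_integrable {f : L2} (hf : Integrable (fun x : ℝ => f x)) :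
    (𝓕 f : L2) =ᵐ[volume] 𝓕 (fun x : ℝ => f x) := by
  have hc := continuous_fourier_of_integrable hf
  -- Both transforms satisfy ∫ f̂ψ = ∫ fψ̂, so they agree against every test function.
  refine ae_eq_of_integral_contDiff_smul_eq ((Lp.memLp _).locallyIntegrable (by norm_num))
    hc.locallyIntegrable fun g g_smooth g_cpt => ?_
  have hg₁ : HasCompactSupport (Complex.ofRealCLM ∘ g) := g_cpt.comp_left rfl
  have hg₂ : ContDiff ℝ (⊤ : ℕ∞) (Complex.ofRealCLM ∘ g) := by fun_prop
  set ψ : 𝓢(ℝ, ℂ) := hg₁.toSchwartzMap hg₂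
  have h1 := toDistr_fourier f ψ
  rw [toDistr_apply, toDistr_apply] at h1
  have h2 := VectorFourier.integral_fourierIntegral_smul_eq_flip (L := innerₗ ℝ)
    Real.continuous_fourierChar continuous_inner hf (ψ.integrable (μ := volume))
  calc ∫ x, g x • (𝓕 f : L2) x = ∫ x, ψ x * (𝓕 f : L2) x := rfl
    _ = ∫ x, (𝓕 ψ) x * f x := h1.symm
    _ = ∫ x, f x • (𝓕 (ψ : ℝ → ℂ)) x := by
        refine integral_congr_ae (Filter.Eventually.of_forall fun x => ?_)
        simp only [smul_eq_mul, SchwartzMap.fourier_coe, mul_comm]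
    _ = ∫ x, (𝓕 (fun x : ℝ => f x)) x • ψ x := by
        rw [flip_innerₗ] at h2
        exact h2.symm
    _ = _ := by
        refine integral_congr_ae (Filter.Eventually.of_forall fun x => ?_)
        exact mul_comm _ _

theorem fourier_apply_zero (f : ℝ → ℂ) : 𝓕 f 0 = ∫ x, f x := by
  rw [Real.fourier_real_eq]; simp

theorem ae_norm_fourier_le {f : L2} (hf : Integrable (fun x : ℝ => f x)) :
    ∀ᵐ x, ‖(𝓕 f : L2) x‖ ≤ normL1 f := by
  filter_upwards [coeFn_fourier_of_integrable hf] with x hx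
  rw [hx]
  exact VectorFourier.norm_fourierIntegral_le_integral_norm _ _ _ _ _

/-- Near the zero frequency the Fourier transform is bounded below by half the mass. -/
theorem exists_low_mass_le {f : L2} (hf : Integrable (fun x : ℝ => f x)) (hm : mass f ≠ 0) :
    ∃ κ > 0, ∀ᵐ x, x ∈ low κ → ‖mass f‖ / 2 ≤ ‖(𝓕 f : L2) x‖ := by
  have hc := (continuous_fourier_of_integrable hf).norm.continuousAt (x := 0)
  have h0 : ‖mass f‖ / 2 < ‖𝓕 (fun x : ℝ => f x) 0‖ := by
    rw [fourier_apply_zero]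
    exact half_lt_self (norm_pos_iff.2 hm)
  obtain ⟨r, hr, hball⟩ := Metric.eventually_nhds_iff.1 (hc.eventually (lt_mem_nhds h0))
  refine ⟨r, hr, ?_⟩
  filter_upwards [coeFn_fourier_of_integrable hf] with x hx hxl
  rw [hx]
  refine (hball ?_).le
  rw [Real.dist_eq, sub_zero]
  have h1 : |2 * Real.pi * x| ≤ r := hxl
  rw [abs_mul, abs_of_pos Real.two_pi_pos] at h1
  by_contra! h2
  nlinarith [Real.pi_gt_three]

/-! ### Bounds for mild solutions -/

theorem low_mono {κ κ' : ℝ} (h : κ ≤ κ') : low κ ⊆ low κ' := fun _ hx => le_trans hx h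

theorem norm_add_normL1_le_dataSize (l : ℝ) (u₀ u₁ : L2) :
    ‖u₀‖ + normL1 u₁ ≤ dataSize l u₀ u₁ := by
  have h1 : ∀ f : L2, 0 ≤ normL1 f := fun f => integral_nonneg fun x => norm_nonneg _
  have h2 : ∀ f : L2, 0 ≤ normL11 f := fun f => integral_nonneg fun x => by positivity
  have h3 : ∀ s, ∀ f : L2, 0 ≤ normD s f := fun s f => Real.sqrt_nonneg _
  rw [dataSize]
  linarith [h1 u₀, h2 u₀, h2 u₁, h3 l u₀, h3 (l - 1) u₁, norm_nonneg u₁]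

/-- The upper bound for mild solutions. -/
theorem IsMildSolution.norm_le {u₀ u₁ : L2} {u : ℝ → L2} (hu : IsMildSolution u₀ u₁ u)
    (h₁ : MemL11 u₁) (l : ℝ) {t : ℝ} (ht : 1 ≤ t) :
    ‖u t‖ ≤ 3 * dataSize l u₀ u₁ * Real.sqrt t := by
  have hs : 1 ≤ Real.sqrt t := Real.one_le_sqrt.2 ht
  have hM : 0 ≤ normL1 u₁ := integral_nonneg fun x => norm_nonneg _
  have h := hu.isDampedOscillation.norm_le hM
    (by simpa only [hu.init_deriv] using ae_norm_fourier_le h₁.1) (by linarith : 0 < t)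
  simp only [Lp.norm_fourier_eq, hu.init] at h
  have hd := norm_add_normL1_le_dataSize l u₀ u₁
  have h1 : ‖u₀‖ ≤ ‖u₀‖ * Real.sqrt t := le_mul_of_one_le_right (norm_nonneg _) hs
  have h2 : (‖u₀‖ + normL1 u₁) * Real.sqrt t ≤ dataSize l u₀ u₁ * Real.sqrt t :=
    mul_le_mul_of_nonneg_right hd (by positivity)
  have h3 : 0 ≤ normL1 u₁ * Real.sqrt t := by positivity
  linarith

/-- The lower bound for mild solutions. -/
theorem IsMildSolution.exists_le_norm {u₀ u₁ : L2} {u : ℝ → L2} (hu : IsMildSolution u₀ u₁ u)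
    (h₁ : MemL11 u₁) :
    ∃ T : ℝ, ∀ t : ℝ, T ≤ t → 1 / 32 * ‖mass u₁‖ * Real.sqrt t ≤ ‖u t‖ := by
  by_cases hm : mass u₁ = 0
  · exact ⟨0, fun t _ => by simp [hm]⟩
  have hp : 0 < ‖mass u₁‖ := norm_pos_iff.2 hm
  obtain ⟨κ, hκ, hlow⟩ := exists_low_mass_le h₁.1 hm
  -- The second entry puts the band |ξ| ≤ 1/(4t) inside the one where the transform of u₁ exceeds
  -- half the mass. The third makes 2‖u₀‖ at most half of the main term |P₁|√t/16, leaving 1/32.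
  refine ⟨max 1 (max (1 / 4 / κ) ((64 * ‖u₀‖ / ‖mass u₁‖) ^ 2)), fun t ht => ?_⟩
  have ht1 : 1 ≤ t := (le_max_left _ _).trans ht
  have ht2 : 1 / 4 / κ ≤ t := (le_max_left _ _).trans ((le_max_right _ _).trans ht)
  have ht3 : (64 * ‖u₀‖ / ‖mass u₁‖) ^ 2 ≤ t :=
    (le_max_right _ _).trans ((le_max_right _ _).trans ht)
  have hle : 1 / 4 / t ≤ κ := by
    rw [div_le_iff₀ (by linarith)]
    rw [div_le_iff₀ hκ] at ht2
    linarith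
  have h := hu.isDampedOscillation.le_norm (m := ‖mass u₁‖ / 2) (by positivity) ht1 (by
    simp only [hu.init_deriv]
    filter_upwards [hlow] with x hx hxl
    exact hx (low_mono hle hxl))
  simp only [Lp.norm_fourier_eq, hu.init] at h
  have h4 : 64 * ‖u₀‖ / ‖mass u₁‖ ≤ Real.sqrt t := Real.le_sqrt_of_sq_le ht3
  rw [div_le_iff₀ hp] at h4
  linarith

end StrongDamping

theorem mainTheorem6 (l : ℝ) (hl : 1 ≤ l) :
    ∃ C₁ C₂ T₀ : ℝ, 0 < C₁ ∧ 0 < C₂ ∧ 0 < T₀ ∧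
      ∀ u₀ u₁ : StrongDamping.L2,
        TemperedDistribution.MemSobolev l 2 (StrongDamping.toDistr u₀) →
        StrongDamping.MemL11 u₀ →
        TemperedDistribution.MemSobolev (l - 1) 2 (StrongDamping.toDistr u₁) →
        StrongDamping.MemL11 u₁ →
        ∀ u : ℝ → StrongDamping.L2, StrongDamping.IsMildSolution u₀ u₁ u →
          (∃ T : ℝ, ∀ t : ℝ, T ≤ t →
            C₁ * ‖StrongDamping.mass u₁‖ * Real.sqrt t ≤ ‖u t‖) ∧
          (∀ t : ℝ, T₀ ≤ t →
            ‖u t‖ ≤ C₂ * StrongDamping.dataSize l u₀ u₁ * Real.sqrt t) := by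
  refine ⟨1 / 32, 3, 1, by norm_num, by norm_num, by norm_num, ?_⟩
  intro u₀ u₁ _ _ _ h₁ u hu
  exact ⟨hu.exists_le_norm h₁, fun t ht => hu.norm_le h₁ l ht⟩
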